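/- \textbf{Theorem 2 (Concentration without centering).} For every integer $r\ge 2$ there is a constant $C_r>0$, depending only on $r$, such that the following holds. Let $d,n\ge 1$ be integers and let $\mathcal B=\{x\in\mathbb R^d:\|x\|\le 1\}$ be the closed Euclidean unit ball. Let $\Sigma\in\mathbb R^{d\times d}$ be a symmetric positive-definite matrix with eigenvalues $\sigma_1^2\ge\sigma_2^2\ge\dots\ge\sigma_d^2>0$ (where $\sigma_i>0$), and put $$d_{\rm eff}(r)=\sum_{i=1}^d\left(\frac{\sigma_i}{\sigma_1}\right)^{2/r}.$$ Let $a_1,\dots,a_n$ be i.i.d. random vectors in $\mathbb R^d$ that are $\Sigma$-subgaussian, that is, $$\mathbb P(|a_i^\top x|>t)\le 2\exp\left(-\frac12\,\frac{t^2}{x^\top\Sigma x}\right)\qquad\text{for all } t>0,\ x\in\mathcal B .$$ Let $f_1,\dots,f_r:\mathbb R\to\mathbb R$ be 1-Lipschitz functions with $f_k(0)=0$ for all $k$, and let $B_1,\dots,B_r>0$ be such that, for all $k\in\{1,\dots,r\}$, $x\in\mathcal B$ and $i\in\{1,\dots,n\}$, $|f_k(a_i^\top x)|\le B_k$ almost surely.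 Let $B=B_1B_2\cdots B_r$ and $$Y=\sup_{x_1,\dots,x_r\in\mathcal B}\ \frac1n\sum_{i=1}^n\prod_{k=1}^r f_k(a_i^\top x_k).$$ Then, for every $\lambda>0$, $$\mathbb P\left(Y\ge \sigma_1^r\,C_r\left(1+\frac{d_{\rm eff}(r)\ln d+\lambda}{n}\,\big(\sigma_1^{-r}B\big)^{1-2/r}\right)\right)\le e^{-\lambda}.$$ -/

import Mathlib

open MeasureTheory ProbabilityTheory
open scoped Matrix

noncomputable section

/-- A random vector `a` of `ℝ^d` is `S`-subgaussian if
`P(|aᵀx| > t) ≤ 2 exp(-(1/2) t² / (xᵀ S x))` for all `t > 0` and all `x` in the closed unit ball.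
At `x = 0` both the usual reading (`exp(-∞) = 0`) and the one below hold automatically. -/
def IsMatrixSubgaussian {Ω : Type*} [MeasurableSpace Ω] (μ : Measure Ω) {d : ℕ}
    (S : Matrix (Fin d) (Fin d) ℝ) (a : Ω → EuclideanSpace ℝ (Fin d)) : Prop :=
  ∀ t : ℝ, 0 < t → ∀ x : EuclideanSpace ℝ (Fin d), ‖x‖ ≤ 1 →
    μ.real {ω | t < |inner ℝ (a ω) x|} ≤
      2 * Real.exp (-(1 / 2) * (t ^ 2 / (x.ofLp ⬝ᵥ (S *ᵥ x.ofLp))))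

/-- The numbers `σ_i`, whose squares are the eigenvalues of `S` with multiplicity
(the enumeration is not required to be sorted). -/
def specSigma {d : ℕ} {S : Matrix (Fin d) (Fin d) ℝ} (hS : S.IsHermitian) (i : Fin d) : ℝ :=
  Real.sqrt (hS.eigenvalues i)

/-- `σ₁`, the largest of the `σ_i`. -/
def specSigmaMax {d : ℕ} {S : Matrix (Fin d) (Fin d) ℝ} (hS : S.IsHermitian) : ℝ :=
  ⨆ i : Fin d, specSigma hS i

/-- The effective dimension `d_eff(s) = ∑ i, (σ_i / σ₁) ^ (2 / s)`. -/
def effDim {d : ℕ} {S : Matrix (Fin d) (Fin d) ℝ} (hS : S.IsHermitian) (s : ℕ) : ℝ :=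
  ∑ i : Fin d, (specSigma hS i / specSigmaMax hS) ^ (2 / (s : ℝ))

/-- The supremum, over `x_1, …, x_r` in the closed unit ball of `ℝ^d`, of
`(1/n) ∑ i, ∏ k, f_k(a_iᵀ x_k)`, for given vectors `a_1, …, a_n`. For Lipschitz `f_k` it is the
supremum of a continuous function over a nonempty compact set. -/
def uncenteredSup {r d n : ℕ} (f : Fin r → ℝ → ℝ) (a : Fin n → EuclideanSpace ℝ (Fin d)) : ℝ :=
  ⨆ x : Fin r → Metric.closedBall (0 : EuclideanSpace ℝ (Fin d)) 1,
    (1 / (n : ℝ)) * ∑ i : Fin n, ∏ k : Fin r,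
      f k (inner ℝ (a i) (x k : EuclideanSpace ℝ (Fin d)))

end

/-! A product of `r` factors is at most the `r`-th power of the largest one, and it is also capped
by `B`. So, with `b = (σ₁^{-r} B)^{1/r}` and `v_k = a_iᵀ x_k / σ₁`, each summand of `Y` is at most
`σ₁^r ∑ k, min(b, |v_k|)^r` (`prod_le_sum_truncPow`). The factors are thereby decoupled and no
centering is needed: it suffices to bound `∑ i, min(b, |⟨G_i, y⟩|)^r` uniformly over the ellipsoid
with semi-axes `τ_l = σ_l / σ₁`, where `G_i` is the whitened `a_i`, with isotropic Gaussian tails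
(`uncenteredSup_le`).

For a single `y` of norm at most `ρ`, the inequality `min(b, |u|)^r ≤ b^{r-2} u²` controls the
exponential moment at parameter of order `1 / (ρ² b^{r-2})`. Chernoff then bounds the sum by a mean
term of order `n ρ^r` plus a deviation of order `ρ² b^{r-2} D`, except with probability `e^{-D}`
(`measureReal_sum_truncPow_ge_le`).

Uniformity comes from chaining at the scales `(3/4)^s` (`exists_chaining`). A link at scale `s` uses
only the coordinates with `τ_l ≥ (3/4)^s`, so its net has at most `5` to that number of points.
Truncation is subadditive, and Jensen with weights `w^s`, `w = (3/4)^{2/r}`, splits the `r`-th power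
over the scales; since `w^r = (3/4)²`, the loss cancels exactly against the `ρ²` of the deviation.
The remaining entropy is `∑ s, w^s #{l : τ_l ≥ (3/4)^s}`, at most a constant times `∑ l, τ_l^{2/r} =
d_eff(r)`: this is where the exponent `2/r` originates. The resulting bound involves `d_eff + λ +
1`, and `ln d` only serves to absorb constants; for `d = 1` it vanishes and a one-point bound
suffices. -/

/-! ### Exponential moments of variables with Gaussian tails -/

/-- The Gaussian tail bound defining subgaussian random variables with variance proxy `1`. -/
def HasGaussianTail {Ω : Type*} [MeasurableSpace Ω] (μ : Measure Ω) (X : Ω → ℝ) : Prop :=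
  ∀ t : ℝ, 0 < t → μ.real {ω | t < |X ω|} ≤ 2 * Real.exp (-(t ^ 2 / 2))

/-- The terms bounding the layers of `E exp (X ^ 2 / 4)`. -/
noncomputable def squareLayer (k : ℕ) : ℝ := Real.exp ((k + 1) / 4) * (2 * Real.exp (-(k / 2 : ℝ)))

lemma squareLayer_nonneg (k : ℕ) : 0 ≤ squareLayer k := by unfold squareLayer; positivity

lemma summable_squareLayer : Summable squareLayer := by
  have h : squareLayer = fun k : ℕ => (2 * Real.exp (1 / 4)) * Real.exp (-(1 / 4)) ^ k := by
    funext k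
    rw [squareLayer, ← Real.exp_nat_mul, mul_left_comm, mul_assoc, ← Real.exp_add, ← Real.exp_add]
    congr 2; ring
  rw [h]
  exact (summable_geometric_of_lt_one (Real.exp_pos _).le (by simp)).mul_left _

/-- A bound for `E exp (X ^ 2 / 4)`. -/
noncomputable def expSquareConst : ℝ := 1 + ∑' k, squareLayer k

lemma expSquareConst_pos : 0 < expSquareConst := by
  have : 0 ≤ ∑' k, squareLayer k := tsum_nonneg squareLayer_nonneg
  unfold expSquareConst; linarith

/-- The single layer `k < x² ≤ k + 1` already dominates; the leading `1` covers `x = 0`. Layer `k`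
has probability at most `2 exp (-k/2)`, which beats its height `exp ((k + 1)/4)`. -/
lemma exp_square_le_layers (x : ℝ) :
    ENNReal.ofReal (Real.exp (x ^ 2 / 4)) ≤ 1 + ∑' k : ℕ,
      (if (k : ℝ) < x ^ 2 then ENNReal.ofReal (Real.exp ((k + 1) / 4)) else 0) := by
  rcases eq_or_ne x 0 with rfl | hx
  · simp
  have hx2 : 0 < x ^ 2 := by positivity
  obtain ⟨k, hk⟩ : ∃ k, ⌈x ^ 2⌉₊ = k + 1 :=
    ⟨⌈x ^ 2⌉₊ - 1, by have := Nat.ceil_pos.mpr hx2; omega⟩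
  have h1 : (k : ℝ) < x ^ 2 := Nat.lt_ceil.mp (by omega)
  have h2 : x ^ 2 ≤ k + 1 := by
    have := Nat.le_ceil (x ^ 2); rw [hk] at this; exact_mod_cast this
  refine le_trans ?_ (le_trans (ENNReal.le_tsum k) le_add_self)
  rw [if_pos h1]
  gcongr

lemma lintegral_exp_square_le {Ω : Type*} [MeasurableSpace Ω] (μ : Measure Ω)
    [IsProbabilityMeasure μ] {X : Ω → ℝ} (hX : Measurable X) (h : HasGaussianTail μ X) :
    ∫⁻ ω, ENNReal.ofReal (Real.exp (X ω ^ 2 / 4)) ∂μ ≤ ENNReal.ofReal expSquareConst := by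
  have hms : ∀ k : ℕ, MeasurableSet {ω | (k : ℝ) < X ω ^ 2} := fun k =>
    measurableSet_lt measurable_const (hX.pow_const 2)
  have hm : ∀ k : ℕ, Measurable fun ω =>
      (if (k : ℝ) < X ω ^ 2 then ENNReal.ofReal (Real.exp ((k + 1) / 4)) else 0) := fun k =>
    Measurable.ite (hms k) measurable_const measurable_const
  have hk : ∀ k : ℕ, ∫⁻ ω, (if (k : ℝ) < X ω ^ 2 then ENNReal.ofReal (Real.exp ((k + 1) / 4))
      else 0) ∂μ ≤ ENNReal.ofReal (squareLayer k) := by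
    intro k
    have he : (fun ω => (if (k : ℝ) < X ω ^ 2 then ENNReal.ofReal (Real.exp ((k + 1) / 4)) else 0))
        = {ω | (k : ℝ) < X ω ^ 2}.indicator fun _ => ENNReal.ofReal (Real.exp ((k + 1) / 4)) := by
      funext ω; simp [Set.indicator_apply]
    rw [he, lintegral_indicator_const (hms k), squareLayer, ENNReal.ofReal_mul (Real.exp_pos _).le]
    gcongr
    rw [← ENNReal.ofReal_toReal (measure_ne_top μ {ω | (k : ℝ) < X ω ^ 2})]
    apply ENNReal.ofReal_le_ofReal
    change μ.real _ ≤ _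
    -- The tail bound is available only at positive levels; for `k = 0` it is replaced by the
    -- trivial bound `1 ≤ 2`.
    rcases Nat.eq_zero_or_pos k with rfl | hk
    · refine measureReal_le_one.trans ?_
      simp
    · have h1 := h (Real.sqrt k) (Real.sqrt_pos.mpr (by exact_mod_cast hk))
      rw [Real.sq_sqrt (Nat.cast_nonneg k)] at h1
      refine le_trans (measureReal_mono ?_) h1
      intro ω hω
      have h2 := Real.sqrt_lt_sqrt (Nat.cast_nonneg k) (Set.mem_ofPred_eq ▸ hω)
      rwa [Real.sqrt_sq_eq_abs] at h2
  calc ∫⁻ ω, ENNReal.ofReal (Real.exp (X ω ^ 2 / 4)) ∂μ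
      ≤ ∫⁻ ω, (1 + ∑' k : ℕ, (if (k : ℝ) < X ω ^ 2 then
          ENNReal.ofReal (Real.exp ((k + 1) / 4)) else 0)) ∂μ :=
        lintegral_mono fun ω => exp_square_le_layers (X ω)
    _ = 1 + ∑' k : ℕ, ∫⁻ ω, (if (k : ℝ) < X ω ^ 2 then
          ENNReal.ofReal (Real.exp ((k + 1) / 4)) else 0) ∂μ := by
        rw [lintegral_add_left measurable_const, lintegral_tsum fun k => (hm k).aemeasurable]
        simp
    _ ≤ 1 + ∑' k : ℕ, ENNReal.ofReal (squareLayer k) := by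
        gcongr with k; exact hk k
    _ = ENNReal.ofReal expSquareConst := by
        rw [expSquareConst, ENNReal.ofReal_add zero_le_one (tsum_nonneg squareLayer_nonneg),
          ENNReal.ofReal_tsum_of_nonneg squareLayer_nonneg summable_squareLayer, ENNReal.ofReal_one]

/-- A bound for `E |X| ^ r exp (X ^ 2 / 8)`. -/
noncomputable def momentConst (r : ℕ) : ℝ := (1 + 8 ^ r * r.factorial) * expSquareConst

lemma momentConst_pos (r : ℕ) : 0 < momentConst r := by
  have := expSquareConst_pos
  unfold momentConst; positivity

/-- Half of the exponent `x²/4` pays for the power: `|x|^r ≤ 1 + x^{2r}`, and `x^{2r}` is bounded by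
one term of the series of `exp (x²/8)`. -/
lemma abs_pow_mul_exp_le (r : ℕ) (x : ℝ) :
    |x| ^ r * Real.exp (x ^ 2 / 8) ≤ (1 + 8 ^ r * r.factorial) * Real.exp (x ^ 2 / 4) := by
  have h1 : (x ^ 2 / 8) ^ r / r.factorial ≤ Real.exp (x ^ 2 / 8) :=
    Real.pow_div_factorial_le_exp _ (by positivity) r
  have hf : (0 : ℝ) < r.factorial := by positivity
  have h2 : (x ^ 2) ^ r ≤ 8 ^ r * r.factorial * Real.exp (x ^ 2 / 8) := by
    rw [div_pow, div_div, div_le_iff₀ (by positivity)] at h1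
    linarith
  have h3 : |x| ^ r ≤ 1 + (x ^ 2) ^ r := by
    rw [← sq_abs, ← pow_mul, mul_comm, pow_mul]
    nlinarith [sq_nonneg (|x| ^ r - 1), pow_nonneg (abs_nonneg x) r]
  have h4 : 1 ≤ Real.exp (x ^ 2 / 8) := Real.one_le_exp (by positivity)
  have h5 : Real.exp (x ^ 2 / 4) = Real.exp (x ^ 2 / 8) * Real.exp (x ^ 2 / 8) := by
    rw [← Real.exp_add]; congr 1; ring
  rw [h5, ← mul_assoc]
  gcongr
  linarith

/-! ### Truncated powers and the Chernoff bound at one point -/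

/-- The truncated power `min(b, |u|) ^ r`. -/
noncomputable def truncPow (r : ℕ) (b u : ℝ) : ℝ := min b |u| ^ r

lemma truncPow_nonneg (r : ℕ) {b : ℝ} (hb : 0 ≤ b) (u : ℝ) : 0 ≤ truncPow r b u :=
  pow_nonneg (le_min hb (abs_nonneg u)) r

lemma continuous_truncPow (r : ℕ) (b : ℝ) : Continuous (truncPow r b) :=
  (continuous_const.min continuous_abs).pow r

lemma truncPow_le_pow (r : ℕ) {b : ℝ} (hb : 0 ≤ b) (u : ℝ) : truncPow r b u ≤ |u| ^ r :=
  pow_le_pow_left₀ (le_min hb (abs_nonneg u)) (min_le_right _ _) r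

lemma truncPow_le_bound (r : ℕ) {b : ℝ} (hb : 0 ≤ b) (u : ℝ) : truncPow r b u ≤ b ^ r :=
  pow_le_pow_left₀ (le_min hb (abs_nonneg u)) (min_le_left _ _) r

/-- Capping `r - 2` of the factors by `b` leaves a quadratic, whose exponential moments are finite
under Gaussian tails. This produces the factor `b^{r-2}` of the final bound. -/
lemma truncPow_le_sq {r : ℕ} (hr : 2 ≤ r) {b : ℝ} (hb : 0 ≤ b) (u : ℝ) :
    truncPow r b u ≤ b ^ (r - 2) * u ^ 2 := by
  have h0 := le_min hb (abs_nonneg u)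
  obtain ⟨m, rfl⟩ := Nat.exists_eq_add_of_le' hr
  rw [truncPow, pow_add, Nat.add_sub_cancel, ← sq_abs u]
  gcongr
  · exact min_le_left _ _
  · exact min_le_right _ _

lemma exp_le_one_add_mul_exp (z : ℝ) : Real.exp z ≤ 1 + z * Real.exp z := by
  have h := Real.add_one_le_exp (-z)
  have h2 : Real.exp (-z) * Real.exp z = 1 := by rw [← Real.exp_add]; simp
  nlinarith [Real.exp_pos z]

/-- The parameter is chosen so that the exponent is at most `X²/8`. In `e^z ≤ 1 + z e^z` the
quadratic bound is used only in the exponent, while the factor `z` is bounded by the untruncated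
power; hence the mean contributes `ρ^r`, with no `b`. -/
lemma mgf_truncPow_le {r : ℕ} (hr : 2 ≤ r) {Ω : Type*} [MeasurableSpace Ω] (μ : Measure Ω)
    [IsProbabilityMeasure μ] {X : Ω → ℝ} (hX : Measurable X) (h : HasGaussianTail μ X)
    {b ρ : ℝ} (hb : 0 < b) (hρ : 0 < ρ) :
    mgf (fun ω => truncPow r b (ρ * X ω)) μ (8 * ρ ^ 2 * b ^ (r - 2))⁻¹ ≤
      Real.exp ((8 * ρ ^ 2 * b ^ (r - 2))⁻¹ * (ρ ^ r * momentConst r)) := by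
  set θ := (8 * ρ ^ 2 * b ^ (r - 2))⁻¹ with hθ
  have hθ0 : 0 < θ := by positivity
  have hM := momentConst_pos r
  have hpt : ∀ x : ℝ, Real.exp (θ * truncPow r b (ρ * x)) ≤
      1 + θ * ρ ^ r * (1 + 8 ^ r * r.factorial) * Real.exp (x ^ 2 / 4) := by
    intro x
    have h1 : θ * truncPow r b (ρ * x) ≤ x ^ 2 / 8 := by
      calc θ * truncPow r b (ρ * x) ≤ θ * (b ^ (r - 2) * (ρ * x) ^ 2) := by
            gcongr; exact truncPow_le_sq hr hb.le _
        _ = x ^ 2 / 8 := by rw [hθ]; field_simp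
    have h0 := truncPow_nonneg r hb.le (ρ * x)
    calc Real.exp (θ * truncPow r b (ρ * x))
        ≤ 1 + θ * truncPow r b (ρ * x) * Real.exp (θ * truncPow r b (ρ * x)) :=
          exp_le_one_add_mul_exp _
      _ ≤ 1 + θ * (ρ ^ r * |x| ^ r) * Real.exp (x ^ 2 / 8) := by
          gcongr
          have := truncPow_le_pow r hb.le (ρ * x)
          rwa [abs_mul, abs_of_pos hρ, mul_pow] at this
      _ = 1 + θ * ρ ^ r * (|x| ^ r * Real.exp (x ^ 2 / 8)) := by ring
      _ ≤ 1 + θ * ρ ^ r * ((1 + 8 ^ r * r.factorial) * Real.exp (x ^ 2 / 4)) := by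
          gcongr 1 + θ * ρ ^ r * ?_
          exact abs_pow_mul_exp_le r x
      _ = _ := by ring
  have hE := lintegral_exp_square_le μ hX h
  have hmeas : Measurable fun ω => Real.exp (X ω ^ 2 / 4) := by fun_prop
  have hint : Integrable (fun ω => Real.exp (X ω ^ 2 / 4)) μ := by
    refine ⟨hmeas.aestronglyMeasurable, ?_⟩
    rw [hasFiniteIntegral_iff_ofReal (Filter.Eventually.of_forall fun ω => (Real.exp_pos _).le)]
    exact hE.trans_lt ENNReal.ofReal_lt_top
  have hE' : ∫ ω, Real.exp (X ω ^ 2 / 4) ∂μ ≤ expSquareConst := by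
    rw [integral_eq_lintegral_of_nonneg_ae
      (Filter.Eventually.of_forall fun ω => (Real.exp_pos _).le) hmeas.aestronglyMeasurable]
    exact ENNReal.toReal_le_of_le_ofReal expSquareConst_pos.le hE
  calc mgf (fun ω => truncPow r b (ρ * X ω)) μ θ
      ≤ ∫ ω, (1 + θ * ρ ^ r * (1 + 8 ^ r * r.factorial) * Real.exp (X ω ^ 2 / 4)) ∂μ := by
        refine integral_mono_of_nonneg (Filter.Eventually.of_forall fun ω => (Real.exp_pos _).le)
          ((integrable_const _).add (hint.const_mul _))
          (Filter.Eventually.of_forall fun ω => hpt (X ω))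
    _ = 1 + θ * ρ ^ r * (1 + 8 ^ r * r.factorial) * ∫ ω, Real.exp (X ω ^ 2 / 4) ∂μ := by
        rw [integral_add (integrable_const _) (hint.const_mul _), integral_const_mul]
        simp
    _ ≤ 1 + θ * ρ ^ r * (1 + 8 ^ r * r.factorial) * expSquareConst := by gcongr
    _ = θ * (ρ ^ r * momentConst r) + 1 := by rw [momentConst]; ring
    _ ≤ _ := Real.add_one_le_exp _

/-- A random vector all of whose one-dimensional marginals in directions of norm at most `1` have
Gaussian tails. -/
def HasIsotropicGaussianTail {Ω E : Type*} [MeasurableSpace Ω] [NormedAddCommGroup E]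
    [InnerProductSpace ℝ E] (μ : Measure Ω) (G : Ω → E) : Prop :=
  ∀ y : E, ‖y‖ ≤ 1 → HasGaussianTail μ fun ω => inner ℝ (G ω) y

lemma measureReal_sum_truncPow_ge_le {r : ℕ} (hr : 2 ≤ r) {Ω E : Type*} [MeasurableSpace Ω]
    [NormedAddCommGroup E] [InnerProductSpace ℝ E] [MeasurableSpace E] [BorelSpace E]
    [SecondCountableTopology E] (μ : Measure Ω) [IsProbabilityMeasure μ] {n : ℕ}
    {G : Fin n → Ω → E} (hG : ∀ i, Measurable (G i)) (hind : iIndepFun G μ)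
    (htail : ∀ i, HasIsotropicGaussianTail μ (G i)) {b ρ : ℝ} (hb : 0 < b) (hρ : 0 < ρ)
    {y : E} (hy : ‖y‖ ≤ ρ) (D : ℝ) :
    μ.real {ω | n * (ρ ^ r * momentConst r) + 8 * ρ ^ 2 * b ^ (r - 2) * D ≤
      ∑ i, truncPow r b (inner ℝ (G i ω) y)} ≤ Real.exp (-D) := by
  set θ := (8 * ρ ^ 2 * b ^ (r - 2))⁻¹ with hθ
  have hθ0 : 0 < θ := by positivity
  have hyρ : ∀ g : E, inner ℝ g y = ρ * inner ℝ g (ρ⁻¹ • y) := by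
    intro g; rw [inner_smul_right]; field_simp
  have hn : ‖ρ⁻¹ • y‖ ≤ 1 := by
    rw [norm_smul, norm_inv, Real.norm_of_nonneg hρ.le, inv_mul_le_iff₀ hρ]; simpa
  set X : Fin n → Ω → ℝ := fun i ω => truncPow r b (inner ℝ (G i ω) y) with hXdef
  have hφ : Measurable fun g : E => truncPow r b (inner ℝ g y) :=
    ((continuous_truncPow r b).comp (by fun_prop)).measurable
  have hXm : ∀ i, Measurable (X i) := fun i => hφ.comp (hG i)
  have hXind : iIndepFun X μ := hind.comp (fun _ g => truncPow r b (inner ℝ g y)) fun _ => hφ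
  have hmgf : ∀ i, mgf (X i) μ θ ≤ Real.exp (θ * (ρ ^ r * momentConst r)) := by
    intro i
    have := mgf_truncPow_le hr μ (X := fun ω => inner ℝ (G i ω) (ρ⁻¹ • y))
      ((by fun_prop : Measurable fun g : E => inner ℝ g (ρ⁻¹ • y)).comp (hG i))
      (htail i _ hn) hb hρ
    simpa only [hXdef, hyρ] using this
  have hSm : Measurable (∑ i, X i) := by fun_prop
  have hint : Integrable (fun ω => Real.exp (θ * (∑ i, X i) ω)) μ := by
    refine Integrable.of_bound (C := Real.exp (θ * (n * b ^ r)))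
      (by fun_prop : Measurable _).aestronglyMeasurable (Filter.Eventually.of_forall fun ω => ?_)
    rw [Real.norm_of_nonneg (Real.exp_pos _).le]
    gcongr
    rw [Finset.sum_apply]
    calc ∑ i, X i ω ≤ ∑ _i : Fin n, b ^ r :=
          Finset.sum_le_sum fun i _ => truncPow_le_bound r hb.le _
      _ = n * b ^ r := by simp
  have hch := measure_ge_le_exp_mul_mgf (μ := μ) (X := ∑ i, X i)
    (n * (ρ ^ r * momentConst r) + θ⁻¹ * D) hθ0.le hint
  have hset : {ω | n * (ρ ^ r * momentConst r) + 8 * ρ ^ 2 * b ^ (r - 2) * D ≤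
      ∑ i, truncPow r b (inner ℝ (G i ω) y)} =
      {ω | n * (ρ ^ r * momentConst r) + θ⁻¹ * D ≤ (∑ i, X i) ω} := by
    ext ω; simp [hXdef, hθ, Finset.sum_apply]
  rw [hset]
  refine hch.trans ?_
  rw [hXind.mgf_sum hXm]
  -- The mean part of the threshold cancels the product of the moment generating functions exactly,
  -- leaving `exp (-D)`.
  calc Real.exp (-θ * (n * (ρ ^ r * momentConst r) + θ⁻¹ * D)) * ∏ i, mgf (X i) μ θ
      ≤ Real.exp (-θ * (n * (ρ ^ r * momentConst r) + θ⁻¹ * D)) *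
        ∏ _i : Fin n, Real.exp (θ * (ρ ^ r * momentConst r)) := by
        gcongr with i
        · intro i _; exact mgf_nonneg
        · exact hmgf i
    _ = Real.exp (-D) := by
        rw [Finset.prod_const, Finset.card_univ, Fintype.card_fin, ← Real.exp_nat_mul,
          ← Real.exp_add]
        congr 1; field_simp; ring

/-! ### Nets and chaining of an ellipsoid -/

/-- Every finite-dimensional Euclidean ball of radius `2` is covered by `5 ^ dim` unit balls with
centers in it. -/
lemma exists_unit_net (E : Type*) [NormedAddCommGroup E] [NormedSpace ℝ E] [FiniteDimensional ℝ E] :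
    ∃ N : Finset E, N.card ≤ 5 ^ Module.finrank ℝ E ∧ (∀ q ∈ N, ‖q‖ ≤ 2) ∧
      ∀ x : E, ‖x‖ ≤ 2 → ∃ q ∈ N, ‖x - q‖ ≤ 1 := by
  classical
  let P : ℕ → Prop := fun m => ∃ N : Finset E, N.card = m ∧ (∀ q ∈ N, ‖q‖ ≤ 2) ∧
    ∀ c ∈ N, ∀ d ∈ N, c ≠ d → 1 ≤ ‖c - d‖
  have hbound : ∀ m, P m → m ≤ 5 ^ Module.finrank ℝ E := by
    rintro m ⟨N, rfl, h1, h2⟩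
    exact Besicovitch.card_le_of_separated N h1 h2
  have h0 : P 0 := ⟨∅, by simp⟩
  -- A separated set of maximal cardinality is a net: an uncovered point could be added to it.
  obtain ⟨N, hN, h1, h2⟩ := Nat.findGreatest_spec (P := P) (Nat.zero_le (5 ^ Module.finrank ℝ E)) h0
  refine ⟨N, hN ▸ Nat.findGreatest_le _, h1, fun x hx => ?_⟩
  by_contra! hcon
  have hxN : x ∉ N := fun h => by have := hcon x h; simp at this; linarith
  have hP : P (N.card + 1) := by
    refine ⟨insert x N, Finset.card_insert_of_notMem hxN, ?_, ?_⟩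
    · intro q hq
      rcases Finset.mem_insert.mp hq with rfl | hq
      exacts [hx, h1 q hq]
    · intro c hc d hd hcd
      rcases Finset.mem_insert.mp hc with rfl | hc' <;>
        rcases Finset.mem_insert.mp hd with rfl | hd'
      · exact absurd rfl hcd
      · exact (hcon d hd').le
      · rw [norm_sub_rev]; exact (hcon c hc').le
      · exact h2 c hc' d hd' hcd
  have := Nat.le_findGreatest (hbound _ hP) hP
  omega

/-- The restriction of a vector to a set of coordinates, the others being set to zero. -/
noncomputable def coordRestrict {d : ℕ} (A : Finset (Fin d)) (x : EuclideanSpace ℝ (Fin d)) :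
    EuclideanSpace ℝ (Fin d) :=
  WithLp.toLp 2 fun i => if i ∈ A then x i else 0

lemma norm_coordRestrict_le {d : ℕ} (A : Finset (Fin d)) (x : EuclideanSpace ℝ (Fin d)) :
    ‖coordRestrict A x‖ ≤ ‖x‖ := by
  rw [EuclideanSpace.norm_eq, EuclideanSpace.norm_eq]
  gcongr with i
  simp only [coordRestrict]
  split_ifs <;> simp

/-- A net, at resolution `δ`, of the ball of radius `2 * δ` in the span of a set of coordinates. -/
lemma exists_coord_net {d : ℕ} (A : Finset (Fin d)) {δ : ℝ} (hδ : 0 < δ) :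
    ∃ N : Finset (EuclideanSpace ℝ (Fin d)), N.card ≤ 5 ^ A.card ∧
      (∀ q ∈ N, ‖q‖ ≤ 2 * δ ∧ ∀ i ∉ A, q i = 0) ∧
      ∀ x, ‖coordRestrict A x‖ ≤ 2 * δ → ∃ q ∈ N, ‖coordRestrict A x - q‖ ≤ δ := by
  classical
  obtain ⟨N, h1, h2, h3⟩ := exists_unit_net (EuclideanSpace ℝ A)
  let ι : EuclideanSpace ℝ A → EuclideanSpace ℝ (Fin d) := fun z =>
    WithLp.toLp 2 fun i => if h : i ∈ A then δ * z ⟨i, h⟩ else 0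
  have hnorm : ∀ z, ‖ι z‖ = δ * ‖z‖ := by
    intro z
    rw [EuclideanSpace.norm_eq, EuclideanSpace.norm_eq, ← Real.sqrt_sq hδ.le,
      ← Real.sqrt_mul (sq_nonneg δ)]
    congr 1
    rw [← Finset.sum_subset (Finset.subset_univ A) (fun i _ hi => by simp [ι, hi]),
      Finset.mul_sum, ← Finset.sum_coe_sort A]
    refine Finset.sum_congr rfl fun i _ => ?_
    simp [ι, mul_pow]
  refine ⟨N.image ι, Finset.card_image_le.trans (by simpa using h1), ?_, ?_⟩
  · intro q hq
    obtain ⟨z, hz, rfl⟩ := Finset.mem_image.mp hq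
    refine ⟨?_, fun i hi => by simp [ι, hi]⟩
    rw [hnorm, mul_comm]
    exact mul_le_mul_of_nonneg_right (h2 z hz) hδ.le
  · intro x hx
    let z : EuclideanSpace ℝ A := WithLp.toLp 2 fun i => δ⁻¹ * x i
    have hz : coordRestrict A x = ι z := by
      ext i
      by_cases hi : i ∈ A
      · simp [coordRestrict, ι, z, hi, hδ.ne']
      · simp [coordRestrict, ι, hi]
    have hz2 : ‖z‖ ≤ 2 := by
      rw [hz, hnorm] at hx
      nlinarith
    obtain ⟨q, hq, hzq⟩ := h3 z hz2
    refine ⟨ι q, Finset.mem_image_of_mem _ hq, ?_⟩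
    have : ι z - ι q = ι (z - q) := by
      ext i
      by_cases hi : i ∈ A
      · simp [ι, hi, mul_sub]
      · simp [ι, hi]
    rw [hz, this, hnorm]
    nlinarith

/-- The coordinates along which the semi-axis `τ i` is at least `δ`. -/
noncomputable def activeCoords {d : ℕ} (τ : Fin d → ℝ) (δ : ℝ) : Finset (Fin d) :=
  {i | δ ≤ τ i}

/-- The remainders left at resolution `δ` when an ellipsoid with semi-axes `τ i` is chained. -/
def chainRemainder {d : ℕ} (τ : Fin d → ℝ) (δ : ℝ) : Set (EuclideanSpace ℝ (Fin d)) :=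
  {x | ‖x‖ ≤ 4 * δ ∧ ∑ i ∈ (activeCoords τ δ)ᶜ, (x i / τ i) ^ 2 ≤ 1}

/-- Only active coordinates are discretised, at resolution `2 * δ`; the inactive part has norm at
most `δ` because its semi-axes are below `δ`. The new remainder has norm at most `3 * δ = 4 * (3/4 *
δ)`, whence the ratio `3/4`. The net points vanish on inactive coordinates, so the ellipsoid
constraint there is inherited. -/
lemma exists_chain_net {d : ℕ} {τ : Fin d → ℝ} (hτ : ∀ i, 0 < τ i) {δ : ℝ} (hδ : 0 < δ) :
    ∃ N : Finset (EuclideanSpace ℝ (Fin d)), N.card ≤ 5 ^ (activeCoords τ δ).card ∧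
      (∀ q ∈ N, ‖q‖ ≤ 4 * δ) ∧
      ∀ x ∈ chainRemainder τ δ, ∃ q ∈ N, x - q ∈ chainRemainder τ (3 / 4 * δ) := by
  obtain ⟨N, h1, h2, h3⟩ := exists_coord_net (activeCoords τ δ) (δ := 2 * δ) (by positivity)
  refine ⟨N, h1, fun q hq => (h2 q hq).1.trans (by linarith), fun x ⟨hx, hx'⟩ => ?_⟩
  obtain ⟨q, hq, hxq⟩ := h3 x ((norm_coordRestrict_le _ x).trans (by linarith))
  have hq0 := (h2 q hq).2
  have htail : ‖x - coordRestrict (activeCoords τ δ) x‖ ≤ δ := by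
    rw [EuclideanSpace.norm_eq, Real.sqrt_le_left hδ.le,
      ← Finset.sum_subset (Finset.subset_univ (activeCoords τ δ)ᶜ)
        (fun i _ hi => by simp [coordRestrict, Finset.notMem_compl.mp hi])]
    calc _ ≤ ∑ i ∈ (activeCoords τ δ)ᶜ, δ ^ 2 * (x i / τ i) ^ 2 := by
          refine Finset.sum_le_sum fun i hi => ?_
          have hi' := Finset.mem_compl.mp hi
          have hlt : τ i < δ := by simpa [activeCoords] using hi'
          have hxi : x i = τ i * (x i / τ i) := by field_simp [(hτ i).ne']
          simp only [coordRestrict, PiLp.sub_apply, hi', if_false, sub_zero, Real.norm_eq_abs, sq_abs]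
          rw [hxi, mul_pow, ← hxi]
          have := (hτ i).le
          gcongr
      _ ≤ δ ^ 2 := by
          rw [← Finset.mul_sum]; nlinarith [sq_nonneg δ]
  refine ⟨q, hq, ?_, ?_⟩
  · have : x - q = (coordRestrict (activeCoords τ δ) x - q) +
        (x - coordRestrict (activeCoords τ δ) x) := by abel
    rw [this]
    refine (norm_add_le _ _).trans ?_
    linarith
  · refine le_trans ?_ hx'
    have hsub : (activeCoords τ (3 / 4 * δ))ᶜ ⊆ (activeCoords τ δ)ᶜ := by
      intro i hi
      simp only [activeCoords, Finset.mem_compl, Finset.mem_filter_univ, not_le] at hi ⊢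
      linarith
    calc ∑ i ∈ (activeCoords τ (3 / 4 * δ))ᶜ, ((x - q) i / τ i) ^ 2
        = ∑ i ∈ (activeCoords τ (3 / 4 * δ))ᶜ, (x i / τ i) ^ 2 := by
          refine Finset.sum_congr rfl fun i hi => ?_
          simp [hq0 i (Finset.mem_compl.mp (hsub hi))]
      _ ≤ _ := Finset.sum_le_sum_of_subset_of_nonneg hsub fun i _ _ => sq_nonneg _

/-- The chaining nets of the ellipsoid with semi-axes `τ i`, at the scales `(3 / 4) ^ s`. -/
lemma exists_chaining {d : ℕ} {τ : Fin d → ℝ} (hτ : ∀ i, 0 < τ i) (hτ1 : ∀ i, τ i ≤ 1) :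
    ∃ T : ℕ → Finset (EuclideanSpace ℝ (Fin d)),
      (∀ s, (T s).card ≤ 5 ^ (activeCoords τ ((3 / 4) ^ s)).card) ∧
      (∀ s, ∀ q ∈ T s, ‖q‖ ≤ 4 * (3 / 4) ^ s) ∧
      ∀ y : EuclideanSpace ℝ (Fin d), ∑ i, (y i / τ i) ^ 2 ≤ 1 →
        ∃ q : ℕ → EuclideanSpace ℝ (Fin d), (∀ s, q s ∈ T s) ∧
          Filter.Tendsto (fun m => ∑ s ∈ Finset.range m, q s) Filter.atTop (nhds y) := by
  have hpos : ∀ s : ℕ, (0 : ℝ) < (3 / 4) ^ s := fun s => by positivity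
  choose T hT1 hT2 hT3 using fun s : ℕ => exists_chain_net hτ (hpos s)
  refine ⟨T, hT1, hT2, fun y hy => ?_⟩
  -- The step is made total, with the junk value `0` off the remainder set, so that it can be
  -- iterated.
  have hstep : ∀ s : ℕ, ∀ x : EuclideanSpace ℝ (Fin d), ∃ q, x ∈ chainRemainder τ ((3 / 4) ^ s) →
      q ∈ T s ∧ x - q ∈ chainRemainder τ ((3 / 4) ^ (s + 1)) := by
    intro s x
    by_cases hx : x ∈ chainRemainder τ ((3 / 4) ^ s)
    · obtain ⟨q, hq, hxq⟩ := hT3 s x hx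
      exact ⟨q, fun _ => ⟨hq, by rwa [pow_succ']⟩⟩
    · exact ⟨0, fun h => absurd h hx⟩
  choose g hg using hstep
  let R : ℕ → EuclideanSpace ℝ (Fin d) := fun s => Nat.rec y (fun s x => x - g s x) s
  have hR0 : R 0 = y := rfl
  have hRs : ∀ s, R (s + 1) = R s - g s (R s) := fun s => rfl
  have hmem : ∀ s, R s ∈ chainRemainder τ ((3 / 4) ^ s) := by
    intro s
    induction s with
    | zero =>
      rw [hR0]
      refine ⟨?_, (Finset.sum_le_sum_of_subset_of_nonneg (Finset.subset_univ _)
        fun i _ _ => sq_nonneg _).trans hy⟩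
      -- At scale `0` the ellipsoid lies in the unit ball, because its semi-axes are at most `1`.
      refine le_trans ?_ (by norm_num : (1 : ℝ) ≤ 4 * (3 / 4) ^ 0)
      rw [EuclideanSpace.norm_eq, Real.sqrt_le_left zero_le_one, one_pow]
      refine le_trans (Finset.sum_le_sum fun i _ => ?_) hy
      rw [Real.norm_eq_abs, sq_abs, div_pow, le_div_iff₀ (pow_pos (hτ i) 2)]
      nlinarith [sq_nonneg (y i), hτ i, hτ1 i, pow_le_one₀ (n := 2) (hτ i).le (hτ1 i)]
    | succ s ih => rw [hRs]; exact (hg s _ ih).2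
  refine ⟨fun s => g s (R s), fun s => (hg s _ (hmem s)).1, ?_⟩
  have hsum : ∀ m, ∑ s ∈ Finset.range m, g s (R s) = y - R m := by
    intro m
    induction m with
    | zero => simp [hR0]
    | succ m ih => rw [Finset.sum_range_succ, ih, hRs]; abel
  simp_rw [hsum]
  have hlim : Filter.Tendsto (fun m : ℕ => (4 : ℝ) * (3 / 4) ^ m) Filter.atTop (nhds 0) := by
    simpa using (tendsto_pow_atTop_nhds_zero_of_lt_one (by norm_num : (0 : ℝ) ≤ 3 / 4)
      (by norm_num)).const_mul 4
  have := squeeze_zero_norm (fun m => (hmem m).1) hlim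
  simpa using this.const_sub y

/-! ### Splitting the truncated power over the scales -/

/-- The chaining weights. -/
noncomputable def chainWeight (r : ℕ) : ℝ := (3 / 4 : ℝ) ^ (2 / (r : ℝ))

lemma chainWeight_pos (r : ℕ) : 0 < chainWeight r := by unfold chainWeight; positivity

lemma chainWeight_lt_one {r : ℕ} (hr : 0 < r) : chainWeight r < 1 :=
  Real.rpow_lt_one (by norm_num) (by norm_num) (by positivity)

lemma chainWeight_pow_card {r : ℕ} (hr : 0 < r) : chainWeight r ^ r = (3 / 4) ^ 2 := by
  rw [chainWeight, ← Real.rpow_natCast, ← Real.rpow_mul (by norm_num),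
    div_mul_cancel₀ _ (by positivity)]
  norm_num

/-- This is a geometric tail starting at the first `s0` with `(3/4)^s0 ≤ t`, and its leading term is
`((3/4)^s0)^{2/r} ≤ t^{2/r}`. With `t` a semi-axis, it is the share of one coordinate in the
effective dimension. -/
lemma sum_chainWeight_active_le {r : ℕ} (hr : 0 < r) {t : ℝ} (ht : 0 < t) (m : ℕ) :
    ∑ s ∈ Finset.range m, (if (3 / 4 : ℝ) ^ s ≤ t then chainWeight r ^ s else 0) ≤
      t ^ (2 / (r : ℝ)) * (1 - chainWeight r)⁻¹ := by
  classical
  have hw0 := (chainWeight_pos r).le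
  have hw1 := chainWeight_lt_one hr
  obtain ⟨s0, hs0, hmin⟩ : ∃ s0 : ℕ, (3 / 4 : ℝ) ^ s0 ≤ t ∧ ∀ s, (3 / 4 : ℝ) ^ s ≤ t → s0 ≤ s := by
    have hex : ∃ s : ℕ, (3 / 4 : ℝ) ^ s ≤ t :=
      (exists_pow_lt_of_lt_one ht (by norm_num : (3 / 4 : ℝ) < 1)).imp fun _ h => h.le
    exact ⟨Nat.find hex, Nat.find_spec hex, fun s hs => Nat.find_min' hex hs⟩
  have h1 : chainWeight r ^ s0 ≤ t ^ (2 / (r : ℝ)) := by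
    rw [chainWeight, ← Real.rpow_natCast, ← Real.rpow_mul (by norm_num), mul_comm,
      Real.rpow_mul (by norm_num), Real.rpow_natCast]
    exact Real.rpow_le_rpow (by positivity) hs0 (by positivity)
  calc ∑ s ∈ Finset.range m, (if (3 / 4 : ℝ) ^ s ≤ t then chainWeight r ^ s else 0)
      ≤ ∑ s ∈ Finset.range m, (if s0 ≤ s then chainWeight r ^ s else 0) := by
        refine Finset.sum_le_sum fun s _ => ?_
        by_cases h : (3 / 4 : ℝ) ^ s ≤ t
        · simp [h, hmin s h]
        · rw [if_neg h]; split_ifs <;> positivity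
    _ ≤ ∑ s ∈ Finset.range (s0 + m), (if s0 ≤ s then chainWeight r ^ s else 0) := by
        refine Finset.sum_le_sum_of_subset_of_nonneg (Finset.range_mono (by omega)) fun s _ _ => ?_
        split_ifs <;> positivity
    _ = chainWeight r ^ s0 * ∑ s ∈ Finset.range m, chainWeight r ^ s := by
        rw [Finset.sum_range_add, Finset.sum_eq_zero, zero_add, Finset.mul_sum]
        · simp [pow_add]
        · intro s hs
          rw [if_neg]; simpa using hs
    _ ≤ t ^ (2 / (r : ℝ)) * (1 - chainWeight r)⁻¹ := by
        gcongr
        rw [← tsum_geometric_of_lt_one hw0 hw1]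
        exact (summable_geometric_of_lt_one hw0 hw1).sum_le_tsum _ fun _ _ => by positivity

/-- Jensen's inequality for the `r`-th power, with the normalised weights `w s / ∑ w` at the points
`u s / w s`. -/
lemma pow_sum_le_weighted {r : ℕ} (hr : 0 < r) (t : Finset ℕ) {u w : ℕ → ℝ} {W : ℝ}
    (hu : ∀ s, 0 ≤ u s) (hw : ∀ s, 0 < w s) (hW : ∑ s ∈ t, w s ≤ W) :
    (∑ s ∈ t, u s) ^ r ≤ W ^ (r - 1) * ∑ s ∈ t, w s * (u s / w s) ^ r := by
  obtain ⟨m, rfl⟩ := Nat.exists_eq_add_of_le' hr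
  rcases t.eq_empty_or_nonempty with rfl | ht
  · simp
  set S := ∑ s ∈ t, w s with hS
  have hS0 : 0 < S := Finset.sum_pos (fun s _ => hw s) ht
  have hJ := Real.pow_arith_mean_le_arith_mean_pow t (fun s => w s / S) (fun s => u s / w s)
    (fun s _ => (div_pos (hw s) hS0).le) (by rw [← Finset.sum_div, ← hS, div_self hS0.ne'])
    (fun s _ => div_nonneg (hu s) (hw s).le) (m + 1)
  have h1 : ∑ s ∈ t, w s / S * (u s / w s) = (∑ s ∈ t, u s) / S := by
    rw [Finset.sum_div]
    refine Finset.sum_congr rfl fun s _ => ?_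
    have := (hw s).ne'
    field_simp
  have h2 : ∑ s ∈ t, w s / S * (u s / w s) ^ (m + 1) =
      (∑ s ∈ t, w s * (u s / w s) ^ (m + 1)) / S := by
    rw [Finset.sum_div]
    exact Finset.sum_congr rfl fun s _ => by ring
  have h0 : 0 ≤ ∑ s ∈ t, w s * (u s / w s) ^ (m + 1) :=
    Finset.sum_nonneg fun s _ => mul_nonneg (hw s).le (pow_nonneg (div_nonneg (hu s) (hw s).le) _)
  rw [h1, h2, div_pow, div_le_div_iff₀ (by positivity) hS0, pow_succ S, ← mul_assoc] at hJ
  refine (le_of_mul_le_mul_right hJ hS0).trans ?_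
  rw [Nat.add_sub_cancel, mul_comm]
  gcongr

/-- Subadditivity of `u ↦ min b |u|` lets every link of a chain keep the truncation at the same
level `b`. -/
lemma min_abs_sum_le (t : Finset ℕ) {b : ℝ} (hb : 0 ≤ b) (u : ℕ → ℝ) :
    min b |∑ s ∈ t, u s| ≤ ∑ s ∈ t, min b |u s| := by
  classical
  induction t using Finset.induction_on with
  | empty => simp [hb]
  | insert a t ha ih =>
    rw [Finset.sum_insert ha, Finset.sum_insert ha]
    have h1 := abs_add_le (u a) (∑ s ∈ t, u s)
    have h2 := abs_nonneg (u a)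
    have h3 := abs_nonneg (∑ s ∈ t, u s)
    refine le_trans ?_ (add_le_add_right ih _)
    rcases le_total b |u a| with h | h <;> rcases le_total b |∑ s ∈ t, u s| with h' | h' <;>
      simp only [min_eq_left h, min_eq_right h, min_eq_left h', min_eq_right h']
    · exact (min_le_left _ _).trans (by linarith)
    · exact (min_le_left _ _).trans (by linarith)
    · exact (min_le_left _ _).trans (by linarith)
    · exact (min_le_right _ _).trans h1

lemma sum_truncPow_sum_le {r : ℕ} (hr : 0 < r) {n : ℕ} (t : Finset ℕ) {b : ℝ} (hb : 0 ≤ b)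
    (u : Fin n → ℕ → ℝ) {w c : ℕ → ℝ} {W : ℝ} (hw : ∀ s, 0 < w s) (hW : ∑ s ∈ t, w s ≤ W)
    (hW0 : 0 ≤ W) (hc : ∀ s, ∑ i, truncPow r b (u i s) ≤ c s) :
    ∑ i, truncPow r b (∑ s ∈ t, u i s) ≤ W ^ (r - 1) * ∑ s ∈ t, w s * (c s / w s ^ r) := by
  calc ∑ i, truncPow r b (∑ s ∈ t, u i s)
      ≤ ∑ i, W ^ (r - 1) * ∑ s ∈ t, w s * (min b |u i s| / w s) ^ r := by
        refine Finset.sum_le_sum fun i _ => ?_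
        refine le_trans ?_ (pow_sum_le_weighted hr t (fun s => le_min hb (abs_nonneg (u i s))) hw hW)
        exact pow_le_pow_left₀ (le_min hb (abs_nonneg _)) (min_abs_sum_le t hb _) r
    _ = W ^ (r - 1) * ∑ s ∈ t, w s * ((∑ i, truncPow r b (u i s)) / w s ^ r) := by
        rw [← Finset.mul_sum, Finset.sum_comm]
        congr 1
        refine Finset.sum_congr rfl fun s _ => ?_
        rw [← Finset.mul_sum, Finset.sum_div]
        simp_rw [div_pow]
        rfl
    _ ≤ _ := by
        have := fun s => (hw s).le
        gcongr with s hs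
        · exact this s
        · exact pow_nonneg (this s) r
        · exact hc s

/-! ### Summing the costs of the scales -/

/-- The total mass of the chaining weights. -/
noncomputable def chainMass (r : ℕ) : ℝ := (1 - chainWeight r)⁻¹

/-- The sum of the chaining weights times the number of the scale. -/
noncomputable def chainMoment (r : ℕ) : ℝ := ∑' s : ℕ, ((s : ℝ) + 1) * chainWeight r ^ s

/-- The constant of the uniform bound. -/
noncomputable def chainConst (r : ℕ) : ℝ :=
  chainMass r ^ (r - 1) *
    (chainMass r * (4 ^ r * momentConst r) + 128 * (3 * chainMass r + chainMoment r))

lemma chainMass_pos {r : ℕ} (hr : 0 < r) : 0 < chainMass r :=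
  inv_pos.mpr (sub_pos.mpr (chainWeight_lt_one hr))

lemma sum_chainWeight_le {r : ℕ} (hr : 0 < r) (m : ℕ) :
    ∑ s ∈ Finset.range m, chainWeight r ^ s ≤ chainMass r := by
  have hw0 := (chainWeight_pos r).le
  have hw1 := chainWeight_lt_one hr
  rw [chainMass, ← tsum_geometric_of_lt_one hw0 hw1]
  exact (summable_geometric_of_lt_one hw0 hw1).sum_le_tsum _ fun _ _ => by positivity

lemma chainMoment_nonneg (r : ℕ) : 0 ≤ chainMoment r :=
  tsum_nonneg fun s => mul_nonneg (by positivity) (pow_nonneg (chainWeight_pos r).le s)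

lemma sum_mul_chainWeight_le {r : ℕ} (hr : 0 < r) (m : ℕ) :
    ∑ s ∈ Finset.range m, ((s : ℝ) + 1) * chainWeight r ^ s ≤ chainMoment r := by
  have hw0 := (chainWeight_pos r).le
  have hw1 := chainWeight_lt_one hr
  have hsum : Summable fun s : ℕ => ((s : ℝ) + 1) * chainWeight r ^ s := by
    have h1 := summable_pow_mul_geometric_of_norm_lt_one (R := ℝ) 1
      (r := chainWeight r) (by rwa [Real.norm_of_nonneg hw0])
    refine (h1.add (summable_geometric_of_lt_one hw0 hw1)).congr fun s => ?_
    ring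
  exact hsum.sum_le_tsum _ fun s _ => mul_nonneg (by positivity) (pow_nonneg hw0 s)

lemma chainConst_pos {r : ℕ} (hr : 0 < r) : 0 < chainConst r := by
  have h1 := chainMass_pos hr
  have h2 := momentConst_pos r
  have h3 := chainMoment_nonneg r
  unfold chainConst
  positivity

/-- The logarithmic price paid at scale `s`. -/
noncomputable def chainPrice {d : ℕ} (τ : Fin d → ℝ) (lam : ℝ) (s : ℕ) : ℝ :=
  lam + (activeCoords τ ((3 / 4) ^ s)).card * Real.log 5 + (s + 1) * Real.log 2

/-- Exchanging the sums over scales and coordinates turns the weighted counts of active coordinates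
into a multiple of `∑ i, τ i ^ (2/r)`; the other two parts of the price are summed against the
geometric weights. -/
lemma sum_chainWeight_mul_price_le {r : ℕ} (hr : 0 < r) {d : ℕ} {τ : Fin d → ℝ}
    (hτ : ∀ i, 0 < τ i) {lam : ℝ} (hlam : 0 ≤ lam) (m : ℕ) :
    ∑ s ∈ Finset.range m, chainWeight r ^ s * chainPrice τ lam s ≤
      (3 * chainMass r + chainMoment r) * (lam + ∑ i, τ i ^ (2 / (r : ℝ)) + 1) := by
  have hM := chainMass_pos hr
  have hV := chainMoment_nonneg r
  have h5 : Real.log 5 ≤ 2 := by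
    rw [Real.log_le_iff_le_exp (by norm_num)]
    have : Real.exp 2 = Real.exp 1 * Real.exp 1 := by rw [← Real.exp_add]; norm_num
    rw [this]; nlinarith [Real.exp_one_gt_d9]
  have h5' : 0 ≤ Real.log 5 := Real.log_nonneg (by norm_num)
  have h2 : Real.log 2 ≤ 1 := by linarith [Real.log_two_lt_d9]
  have h2' : 0 ≤ Real.log 2 := Real.log_nonneg (by norm_num)
  have hcard : ∑ s ∈ Finset.range m, chainWeight r ^ s * (activeCoords τ ((3 / 4) ^ s)).card ≤
      (∑ i, τ i ^ (2 / (r : ℝ))) * chainMass r := by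
    calc ∑ s ∈ Finset.range m, chainWeight r ^ s * ((activeCoords τ ((3 / 4) ^ s)).card : ℝ)
        = ∑ s ∈ Finset.range m, ∑ i,
            (if (3 / 4 : ℝ) ^ s ≤ τ i then chainWeight r ^ s else 0) := by
          refine Finset.sum_congr rfl fun s _ => ?_
          rw [← Finset.sum_filter, Finset.sum_const, nsmul_eq_mul, mul_comm]
          rfl
      _ = ∑ i, ∑ s ∈ Finset.range m,
            (if (3 / 4 : ℝ) ^ s ≤ τ i then chainWeight r ^ s else 0) := Finset.sum_comm
      _ ≤ ∑ i, τ i ^ (2 / (r : ℝ)) * chainMass r :=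
          Finset.sum_le_sum fun i _ => sum_chainWeight_active_le hr (hτ i) m
      _ = _ := by rw [Finset.sum_mul]
  have hE : 0 ≤ ∑ i, τ i ^ (2 / (r : ℝ)) :=
    Finset.sum_nonneg fun i _ => Real.rpow_nonneg (hτ i).le _
  set E := ∑ i, τ i ^ (2 / (r : ℝ))
  have hexp : ∑ s ∈ Finset.range m, chainWeight r ^ s * chainPrice τ lam s =
      lam * ∑ s ∈ Finset.range m, chainWeight r ^ s +
      Real.log 5 * ∑ s ∈ Finset.range m, chainWeight r ^ s * (activeCoords τ ((3 / 4) ^ s)).card +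
      Real.log 2 * ∑ s ∈ Finset.range m, ((s : ℝ) + 1) * chainWeight r ^ s := by
    simp_rw [Finset.mul_sum, ← Finset.sum_add_distrib]
    refine Finset.sum_congr rfl fun s _ => ?_
    unfold chainPrice
    ring
  rw [hexp]
  have e1 := mul_le_mul_of_nonneg_left (sum_chainWeight_le hr m) hlam
  have e2 : Real.log 5 * ∑ s ∈ Finset.range m,
      chainWeight r ^ s * ((activeCoords τ ((3 / 4) ^ s)).card : ℝ) ≤ 2 * (E * chainMass r) :=
    mul_le_mul h5 hcard (Finset.sum_nonneg fun s _ =>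
      mul_nonneg (pow_nonneg (chainWeight_pos r).le s) (Nat.cast_nonneg _)) (by norm_num)
  have e3 : Real.log 2 * ∑ s ∈ Finset.range m, ((s : ℝ) + 1) * chainWeight r ^ s ≤
      1 * chainMoment r :=
    mul_le_mul h2 (sum_mul_chainWeight_le hr m) (Finset.sum_nonneg fun s _ =>
      mul_nonneg (by positivity) (pow_nonneg (chainWeight_pos r).le s)) (by norm_num)
  nlinarith [mul_nonneg hM.le hlam, mul_nonneg hM.le hE, mul_nonneg hV hlam, mul_nonneg hV hE]

/-- The level not exceeded, with high probability, by the empirical sums at scale `s`. -/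
noncomputable def chainLevel (r n : ℕ) {d : ℕ} (τ : Fin d → ℝ) (b lam : ℝ) (s : ℕ) : ℝ :=
  n * ((4 * (3 / 4) ^ s) ^ r * momentConst r) +
    8 * (4 * (3 / 4) ^ s) ^ 2 * b ^ (r - 2) * chainPrice τ lam s

/-- With `p = (3/4)^s`, the Jensen divisor is `p²`. It cancels the `p²` of the deviation term,
leaving `8 * 4² = 128`, and is harmless in the mean term since `p^r ≤ p²` for `r ≥ 2`. Neither term
then grows with `s` except through the price. -/
lemma sum_chainLevel_le {r : ℕ} (hr : 2 ≤ r) (n : ℕ) {d : ℕ} {τ : Fin d → ℝ}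
    (hτ : ∀ i, 0 < τ i) {b lam : ℝ} (hb : 0 < b) (hlam : 0 ≤ lam) (m : ℕ) :
    chainMass r ^ (r - 1) * ∑ s ∈ Finset.range m,
      chainWeight r ^ s * (chainLevel r n τ b lam s / (chainWeight r ^ s) ^ r) ≤
      chainConst r * (n + b ^ (r - 2) * (lam + ∑ i, τ i ^ (2 / (r : ℝ)) + 1)) := by
  have hr0 : 0 < r := by omega
  have hM := chainMass_pos hr0
  have hV := chainMoment_nonneg r
  have hK := momentConst_pos r
  have hw := chainWeight_pos r
  have hE : 0 ≤ ∑ i, τ i ^ (2 / (r : ℝ)) :=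
    Finset.sum_nonneg fun i _ => Real.rpow_nonneg (hτ i).le _
  have hterm : ∀ s : ℕ, chainLevel r n τ b lam s / (chainWeight r ^ s) ^ r ≤
      n * (4 ^ r * momentConst r) + 128 * b ^ (r - 2) * chainPrice τ lam s := by
    intro s
    rw [← pow_mul, mul_comm s r, pow_mul, chainWeight_pow_card hr0, ← pow_mul, mul_comm 2 s,
      pow_mul, div_le_iff₀ (by positivity), chainLevel]
    set p : ℝ := (3 / 4) ^ s with hp
    have hp0 : 0 < p := by positivity
    have hp1 : p ≤ 1 := pow_le_one₀ (by norm_num) (by norm_num)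
    have hpr : p ^ r ≤ p ^ 2 := pow_le_pow_of_le_one hp0.le hp1 hr
    have : (n : ℝ) * ((4 * p) ^ r * momentConst r) ≤ n * (4 ^ r * momentConst r) * p ^ 2 := by
      rw [mul_pow]
      calc (n : ℝ) * (4 ^ r * p ^ r * momentConst r) = n * (4 ^ r * momentConst r) * p ^ r := by ring
        _ ≤ _ := by gcongr
    nlinarith
  calc chainMass r ^ (r - 1) * ∑ s ∈ Finset.range m,
        chainWeight r ^ s * (chainLevel r n τ b lam s / (chainWeight r ^ s) ^ r)
      ≤ chainMass r ^ (r - 1) * ∑ s ∈ Finset.range m, chainWeight r ^ s *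
        (n * (4 ^ r * momentConst r) + 128 * b ^ (r - 2) * chainPrice τ lam s) := by
        gcongr with s hs
        exact hterm s
    _ = chainMass r ^ (r - 1) * (n * (4 ^ r * momentConst r) *
          ∑ s ∈ Finset.range m, chainWeight r ^ s + 128 * b ^ (r - 2) *
          ∑ s ∈ Finset.range m, chainWeight r ^ s * chainPrice τ lam s) := by
        congr 1
        simp_rw [Finset.mul_sum, ← Finset.sum_add_distrib]
        exact Finset.sum_congr rfl fun s _ => by ring
    _ ≤ chainMass r ^ (r - 1) * (n * (4 ^ r * momentConst r) * chainMass r + 128 * b ^ (r - 2) *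
          ((3 * chainMass r + chainMoment r) * (lam + ∑ i, τ i ^ (2 / (r : ℝ)) + 1))) := by
        gcongr
        · exact sum_chainWeight_le hr0 m
        · exact sum_chainWeight_mul_price_le hr0 hτ hlam m
    _ ≤ _ := by
        rw [chainConst, mul_assoc (chainMass r ^ (r - 1)) _ (_ + _)]
        refine mul_le_mul_of_nonneg_left ?_ (pow_nonneg hM.le (r - 1))
        set P := b ^ (r - 2) * (lam + ∑ i, τ i ^ (2 / (r : ℝ)) + 1) with hP
        have hP0 : 0 ≤ P := by positivity
        have hA : 0 ≤ chainMass r * (4 ^ r * momentConst r) := by positivity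
        have hB : 0 ≤ 128 * (3 * chainMass r + chainMoment r) := by positivity
        calc _ = chainMass r * (4 ^ r * momentConst r) * n +
              128 * (3 * chainMass r + chainMoment r) * P := by rw [hP]; ring
          _ ≤ _ := by
              have hn : (0 : ℝ) ≤ n := Nat.cast_nonneg n
              nlinarith [mul_nonneg hA hP0, mul_nonneg hB hn]

/-! ### Uniform bound over the ellipsoid -/

/-- Uniform bound for truncated empirical moments over an ellipsoid. -/
lemma measureReal_exists_sum_truncPow_gt_le {r : ℕ} (hr : 2 ≤ r) {Ω : Type*} [MeasurableSpace Ω]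
    (μ : Measure Ω) [IsProbabilityMeasure μ] {n d : ℕ} {G : Fin n → Ω → EuclideanSpace ℝ (Fin d)}
    (hG : ∀ i, Measurable (G i)) (hind : iIndepFun G μ)
    (htail : ∀ i, HasIsotropicGaussianTail μ (G i)) {τ : Fin d → ℝ} (hτ : ∀ i, 0 < τ i)
    (hτ1 : ∀ i, τ i ≤ 1) {b lam : ℝ} (hb : 0 < b) (hlam : 0 ≤ lam) :
    μ.real {ω | ∃ y : EuclideanSpace ℝ (Fin d), ∑ l, (y l / τ l) ^ 2 ≤ 1 ∧
      chainConst r * (n + b ^ (r - 2) * (lam + ∑ l, τ l ^ (2 / (r : ℝ)) + 1)) <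
        ∑ i, truncPow r b (inner ℝ (G i ω) y)} ≤ Real.exp (-lam) := by
  have hr0 : 0 < r := by omega
  obtain ⟨T, hT1, hT2, hT3⟩ := exists_chaining hτ hτ1
  let bad : ℕ → EuclideanSpace ℝ (Fin d) → Set Ω := fun s q =>
    {ω | chainLevel r n τ b lam s ≤ ∑ i, truncPow r b (inner ℝ (G i ω) q)}
  have hbad : ∀ s, ∀ q ∈ T s, μ (bad s q) ≤ ENNReal.ofReal (Real.exp (-chainPrice τ lam s)) := by
    intro s q hq
    rw [← ENNReal.ofReal_toReal (measure_ne_top μ (bad s q))]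
    exact ENNReal.ofReal_le_ofReal
      (measureReal_sum_truncPow_ge_le hr μ hG hind htail hb (by positivity) (hT2 s q hq) _)
  have hscale : ∀ s, μ (⋃ q ∈ T s, bad s q) ≤
      ENNReal.ofReal (Real.exp (-lam) * (1 / 2 * (1 / 2) ^ s)) := by
    intro s
    calc μ (⋃ q ∈ T s, bad s q) ≤ ∑ q ∈ T s, μ (bad s q) := measure_biUnion_finset_le _ _
      _ ≤ ∑ _q ∈ T s, ENNReal.ofReal (Real.exp (-chainPrice τ lam s)) :=
          Finset.sum_le_sum (hbad s)
      _ = ENNReal.ofReal ((T s).card * Real.exp (-chainPrice τ lam s)) := by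
          rw [Finset.sum_const, nsmul_eq_mul, ENNReal.ofReal_mul (Nat.cast_nonneg _),
            ENNReal.ofReal_natCast]
      _ ≤ ENNReal.ofReal (5 ^ (activeCoords τ ((3 / 4) ^ s)).card *
            Real.exp (-chainPrice τ lam s)) := by
          gcongr
          exact_mod_cast hT1 s
      _ = _ := by
          congr 1
          -- The price is designed for this union bound: its `log 5` part pays for the net, and its
          -- `log 2` part leaves `2^{-(s+1)}`, which sums to `1` over the scales.
          set k := (activeCoords τ ((3 / 4) ^ s)).card with hk
          have : -chainPrice τ lam s = -lam + (-(k * Real.log 5)) +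
              (-(((s + 1 : ℕ) : ℝ) * Real.log 2)) := by
            rw [chainPrice]; push_cast; ring
          rw [this, Real.exp_add, Real.exp_add, Real.exp_neg (k * _), Real.exp_neg (_ * Real.log 2),
            Real.exp_nat_mul, Real.exp_nat_mul, Real.exp_log (by norm_num),
            Real.exp_log (by norm_num), pow_succ, div_pow, one_pow]
          field_simp
  have hall : μ (⋃ s, ⋃ q ∈ T s, bad s q) ≤ ENNReal.ofReal (Real.exp (-lam)) := by
    refine (measure_iUnion_le _).trans ((ENNReal.tsum_le_tsum hscale).trans ?_)
    have hs : Summable fun s : ℕ => Real.exp (-lam) * (1 / 2 * (1 / 2 : ℝ) ^ s) :=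
      (summable_geometric_two.mul_left _).mul_left _
    rw [← ENNReal.ofReal_tsum_of_nonneg (fun s => by positivity) hs, tsum_mul_left, tsum_mul_left,
      tsum_geometric_two]
    norm_num
  refine ENNReal.toReal_le_of_le_ofReal (Real.exp_pos _).le (le_trans (measure_mono ?_) hall)
  rintro ω ⟨y, hy, hgt⟩
  by_contra hω
  simp only [Set.mem_iUnion, not_exists, bad] at hω
  obtain ⟨q, hq, hlim⟩ := hT3 y hy
  -- Off the bad events the bound holds for every partial sum of the chain, uniformly in its length,
  -- and passes to the limit by continuity.
  refine hgt.not_ge (le_of_tendsto' (x := Filter.atTop)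
    (f := fun m => ∑ i, truncPow r b (inner ℝ (G i ω) (∑ s ∈ Finset.range m, q s))) ?_ ?_)
  · refine tendsto_finsetSum _ fun i _ => ?_
    exact (((continuous_truncPow r b).comp (by fun_prop : Continuous fun z =>
      inner ℝ (G i ω) z)).tendsto y).comp hlim
  · intro m
    simp_rw [inner_sum]
    exact (sum_truncPow_sum_le hr0 (Finset.range m) hb.le (fun i s => inner ℝ (G i ω) (q s))
      (fun s => pow_pos (chainWeight_pos r) s) (sum_chainWeight_le hr0 m) (chainMass_pos hr0).le
      (fun s => (not_le.mp (hω s (q s) (hq s))).le)).trans (sum_chainLevel_le hr n hτ hb hlam m)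

/-! ### Whitening in the eigenbasis of the covariance proxy -/

section Whitening

variable {d : ℕ} {S : Matrix (Fin d) (Fin d) ℝ}

lemma quadForm_eq_sum_eigenvalues (hS : S.IsHermitian) (x : EuclideanSpace ℝ (Fin d)) :
    x.ofLp ⬝ᵥ (S *ᵥ x.ofLp) = ∑ l, hS.eigenvalues l * inner ℝ x (hS.eigenvectorBasis l) ^ 2 := by
  have hinner : ∀ u w : EuclideanSpace ℝ (Fin d), inner ℝ u w = u.ofLp ⬝ᵥ w.ofLp := by
    intro u w
    rw [EuclideanSpace.inner_eq_star_dotProduct, dotProduct_comm]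
    simp
  have hT : Sᵀ = S := by simpa using hS.eq
  have h1 : x.ofLp ⬝ᵥ (S *ᵥ x.ofLp) = inner ℝ x (WithLp.toLp 2 (S *ᵥ x.ofLp)) := by rw [hinner]
  rw [h1, ← hS.eigenvectorBasis.sum_inner_mul_inner]
  refine Finset.sum_congr rfl fun l _ => ?_
  have h2 : inner ℝ (hS.eigenvectorBasis l) (WithLp.toLp 2 (S *ᵥ x.ofLp)) =
      hS.eigenvalues l * inner ℝ x (hS.eigenvectorBasis l) := by
    rw [hinner, hinner, Matrix.dotProduct_mulVec, ← Matrix.mulVec_transpose, hT,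
      hS.mulVec_eigenvectorBasis, smul_dotProduct, dotProduct_comm, smul_eq_mul]
  rw [h2]; ring

lemma specSigma_pos (hS : S.PosDef) (l : Fin d) : 0 < specSigma hS.isHermitian l :=
  Real.sqrt_pos.mpr (hS.eigenvalues_pos l)

lemma specSigma_le_max (hS : S.IsHermitian) (l : Fin d) : specSigma hS l ≤ specSigmaMax hS :=
  le_ciSup (Set.finite_range _).bddAbove l

lemma specSigmaMax_pos (hS : S.PosDef) (hd : 1 ≤ d) : 0 < specSigmaMax hS.isHermitian :=
  (specSigma_pos hS ⟨0, hd⟩).trans_le (specSigma_le_max _ _)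

/-- The largest eigenvalue alone contributes `1`. This allows additive constants to be absorbed into
the effective dimension. -/
lemma one_le_effDim (hS : S.PosDef) (hd : 1 ≤ d) (s : ℕ) : 1 ≤ effDim hS.isHermitian s := by
  have : Nonempty (Fin d) := ⟨⟨0, hd⟩⟩
  obtain ⟨l, hl⟩ := exists_eq_ciSup_of_finite (f := specSigma hS.isHermitian)
  have hpos := specSigmaMax_pos hS hd
  have h1 : (specSigma hS.isHermitian l / specSigmaMax hS.isHermitian) ^ (2 / (s : ℝ)) = 1 := by
    rw [hl, specSigmaMax, div_self (by rw [← specSigmaMax]; exact hpos.ne'), Real.one_rpow]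
  rw [effDim, ← h1]
  exact Finset.single_le_sum (f := fun i => (specSigma hS.isHermitian i /
    specSigmaMax hS.isHermitian) ^ (2 / (s : ℝ))) (fun i _ => Real.rpow_nonneg
    (div_nonneg (specSigma_pos hS i).le hpos.le) _) (Finset.mem_univ l)

/-- The coordinates of `S ^ (-1/2) a` in the eigenvector basis of `S`. -/
noncomputable def whiten (hS : S.IsHermitian) (g : EuclideanSpace ℝ (Fin d)) :
    EuclideanSpace ℝ (Fin d) :=
  WithLp.toLp 2 fun l => inner ℝ g (hS.eigenvectorBasis l) / specSigma hS l

/-- The vector `S ^ (-1/2) y`, where `y` is given in the eigenvector basis of `S`. -/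
noncomputable def unwhiten (hS : S.IsHermitian) (y : EuclideanSpace ℝ (Fin d)) :
    EuclideanSpace ℝ (Fin d) :=
  ∑ l, (y l / specSigma hS l) • hS.eigenvectorBasis l

lemma measurable_whiten (hS : S.IsHermitian) : Measurable (whiten hS) := by
  have : Continuous (whiten hS) := by
    unfold whiten
    refine (PiLp.continuous_toLp 2 _).comp (continuous_pi fun l => ?_)
    fun_prop
  exact this.measurable

lemma inner_whiten (hS : S.IsHermitian) (g y : EuclideanSpace ℝ (Fin d)) :
    inner ℝ (whiten hS g) y = inner ℝ g (unwhiten hS y) := by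
  rw [unwhiten, inner_sum, PiLp.inner_apply]
  refine Finset.sum_congr rfl fun l _ => ?_
  rw [inner_smul_right]
  simp [whiten]
  ring

lemma inner_unwhiten_basis (hS : S.IsHermitian) (y : EuclideanSpace ℝ (Fin d)) (l : Fin d) :
    inner ℝ (unwhiten hS y) (hS.eigenvectorBasis l) = y l / specSigma hS l := by
  rw [real_inner_comm, unwhiten, inner_sum, Finset.sum_eq_single l]
  · rw [inner_smul_right, hS.eigenvectorBasis.inner_eq_one, mul_one]
  · intro j _ hj
    rw [inner_smul_right, hS.eigenvectorBasis.inner_eq_zero hj.symm, mul_zero]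
  · simp

lemma quadForm_unwhiten (hS : S.PosDef) (y : EuclideanSpace ℝ (Fin d)) :
    (unwhiten hS.isHermitian y).ofLp ⬝ᵥ (S *ᵥ (unwhiten hS.isHermitian y).ofLp) = ‖y‖ ^ 2 := by
  rw [quadForm_eq_sum_eigenvalues hS.isHermitian, EuclideanSpace.norm_sq_eq]
  refine Finset.sum_congr rfl fun l _ => ?_
  have h0 := hS.eigenvalues_pos l
  rw [inner_unwhiten_basis, div_pow, specSigma, Real.sq_sqrt h0.le, Real.norm_eq_abs, sq_abs,
    mul_div_cancel₀ _ h0.ne']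

/-- The quadratic form at the unwhitened direction equals `‖y‖²`, so the variance proxy becomes at
most `1`. -/
lemma IsMatrixSubgaussian.whiten {Ω : Type*} [MeasurableSpace Ω] {μ : Measure Ω}
    (hS : S.PosDef) {g : Ω → EuclideanSpace ℝ (Fin d)} (h : IsMatrixSubgaussian μ S g) :
    HasIsotropicGaussianTail μ fun ω => whiten hS.isHermitian (g ω) := by
  intro y hy t ht
  simp_rw [inner_whiten]
  set x := unwhiten hS.isHermitian y with hx
  have hq : x.ofLp ⬝ᵥ (S *ᵥ x.ofLp) = ‖y‖ ^ 2 := quadForm_unwhiten hS y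
  rcases eq_or_ne x 0 with h0 | h0
  · simp [h0, ht.le.not_gt]
    positivity
  have hxn : 0 < ‖x‖ := norm_pos_iff.mpr h0
  have hy0 : 0 < ‖y‖ := by
    rw [norm_pos_iff]
    rintro rfl
    exact h0 (by simp [hx, unwhiten])
  -- The unwhitened direction may leave the unit ball, where nothing is assumed; it is normalised
  -- and the level rescaled, which leaves the event and the ratio in the exponent unchanged.
  have h1 := h (t / ‖x‖) (by positivity) (‖x‖⁻¹ • x) (by
    rw [norm_smul, norm_inv, norm_norm, inv_mul_cancel₀ hxn.ne'])
  have hset : {ω | t / ‖x‖ < |inner ℝ (g ω) (‖x‖⁻¹ • x)|} = {ω | t < |inner ℝ (g ω) x|} := by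
    ext ω
    rw [Set.mem_ofPred_eq, Set.mem_ofPred_eq, inner_smul_right, abs_mul, abs_inv, abs_norm,
      div_eq_inv_mul, mul_lt_mul_iff_right₀ (by positivity)]
  rw [hset] at h1
  refine h1.trans ?_
  have hq' : (‖x‖⁻¹ • x).ofLp ⬝ᵥ (S *ᵥ (‖x‖⁻¹ • x).ofLp) = ‖y‖ ^ 2 / ‖x‖ ^ 2 := by
    rw [WithLp.ofLp_smul, Matrix.mulVec_smul, dotProduct_smul, smul_dotProduct, hq]
    simp only [smul_eq_mul]
    field_simp
  have hy2 : ‖y‖ ^ 2 ≤ 1 := pow_le_one₀ (norm_nonneg y) hy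
  have hratio : t ^ 2 ≤ (t / ‖x‖) ^ 2 / (‖y‖ ^ 2 / ‖x‖ ^ 2) := by
    have : (t / ‖x‖) ^ 2 / (‖y‖ ^ 2 / ‖x‖ ^ 2) = t ^ 2 / ‖y‖ ^ 2 := by field_simp
    rw [this, le_div_iff₀ (by positivity)]
    nlinarith [sq_nonneg t]
  rw [hq']
  gcongr
  linarith

/-- A vector `x` of the unit ball, rescaled to the ellipsoid with semi-axes `σ_l / σ₁`. -/
noncomputable def ellipsoidPoint (hS : S.IsHermitian) (x : EuclideanSpace ℝ (Fin d)) :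
    EuclideanSpace ℝ (Fin d) :=
  WithLp.toLp 2 fun l => specSigma hS l / specSigmaMax hS * hS.eigenvectorBasis.repr x l

lemma inner_eq_mul_inner_whiten (hS : S.PosDef) (hd : 1 ≤ d) (g x : EuclideanSpace ℝ (Fin d)) :
    inner ℝ g x = specSigmaMax hS.isHermitian *
      inner ℝ (whiten hS.isHermitian g) (ellipsoidPoint hS.isHermitian x) := by
  have hpos := specSigmaMax_pos hS hd
  have : unwhiten hS.isHermitian (ellipsoidPoint hS.isHermitian x) =
      (specSigmaMax hS.isHermitian)⁻¹ • x := by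
    conv_rhs => rw [← hS.isHermitian.eigenvectorBasis.sum_repr x, Finset.smul_sum]
    refine Finset.sum_congr rfl fun l _ => ?_
    rw [smul_smul]
    congr 1
    have := (specSigma_pos hS l).ne'
    simp only [ellipsoidPoint]
    field_simp
  rw [inner_whiten, this, inner_smul_right]
  field_simp

lemma sum_ellipsoidPoint_sq (hS : S.PosDef) (hd : 1 ≤ d) (x : EuclideanSpace ℝ (Fin d)) :
    ∑ l, (ellipsoidPoint hS.isHermitian x l /
      (specSigma hS.isHermitian l / specSigmaMax hS.isHermitian)) ^ 2 = ‖x‖ ^ 2 := by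
  have hpos := specSigmaMax_pos hS hd
  rw [← hS.isHermitian.eigenvectorBasis.repr.norm_map x, EuclideanSpace.norm_sq_eq]
  refine Finset.sum_congr rfl fun l _ => ?_
  have := (specSigma_pos hS l).ne'
  rw [Real.norm_eq_abs, sq_abs]
  congr 1
  simp only [ellipsoidPoint]
  field_simp

end Whitening

/-! ### Reduction of the supremum to truncated moments -/

/-- The product is at most `s^r` times both `b^r` and the `r`-th power of the largest `|v k|`, hence
at most `s^r` times the truncated power of that largest value. Summing over `k` removes the
dependence on the maximiser. -/
lemma prod_le_sum_truncPow {r : ℕ} (hr : 0 < r) {s b : ℝ} (hs : 0 ≤ s) (hb : 0 ≤ b)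
    {c v : Fin r → ℝ} (hcv : ∀ k, |c k| ≤ s * |v k|) (hcb : ∏ k, |c k| ≤ s ^ r * b ^ r) :
    ∏ k, c k ≤ s ^ r * ∑ k, truncPow r b (v k) := by
  have : Nonempty (Fin r) := ⟨⟨0, hr⟩⟩
  obtain ⟨j, hj⟩ := Finite.exists_max fun k => |v k|
  have h1 : ∏ k, c k ≤ ∏ k, |c k| := by
    rw [← Finset.abs_prod]; exact le_abs_self _
  have h2 : ∏ k, |c k| ≤ s ^ r * |v j| ^ r := by
    calc ∏ k, |c k| ≤ ∏ _k : Fin r, (s * |v j|) :=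
          Finset.prod_le_prod (fun k _ => abs_nonneg _) fun k _ =>
            (hcv k).trans (mul_le_mul_of_nonneg_left (hj k) hs)
      _ = s ^ r * |v j| ^ r := by simp [mul_pow]
  have h3 : ∏ k, |c k| ≤ s ^ r * truncPow r b (v j) := by
    rw [truncPow]
    rcases le_total b |v j| with h | h
    · rwa [min_eq_left h]
    · rwa [min_eq_right h]
  refine h1.trans (h3.trans (mul_le_mul_of_nonneg_left ?_ (pow_nonneg hs r)))
  exact Finset.single_le_sum (f := fun k => truncPow r b (v k))
    (fun k _ => truncPow_nonneg r hb _) (Finset.mem_univ j)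

/-- The exceptional null set may depend on the point of the ball; a countable dense set and
continuity give a common one. -/
lemma ae_forall_abs_le {Ω : Type*} [MeasurableSpace Ω] {μ : Measure Ω} {r d n : ℕ}
    {a : Fin n → Ω → EuclideanSpace ℝ (Fin d)} {f : Fin r → ℝ → ℝ}
    (hf : ∀ k, Continuous (f k)) {B : Fin r → ℝ}
    (hB : ∀ k, ∀ x : EuclideanSpace ℝ (Fin d), ‖x‖ ≤ 1 → ∀ i,
      ∀ᵐ ω ∂μ, |f k (inner ℝ (a i ω) x)| ≤ B k) :
    ∀ᵐ ω ∂μ, ∀ k i, ∀ x : Metric.closedBall (0 : EuclideanSpace ℝ (Fin d)) 1,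
      |f k (inner ℝ (a i ω) (x : EuclideanSpace ℝ (Fin d)))| ≤ B k := by
  have : Nonempty (Metric.closedBall (0 : EuclideanSpace ℝ (Fin d)) 1) := ⟨⟨0, by simp⟩⟩
  let z := TopologicalSpace.denseSeq (Metric.closedBall (0 : EuclideanSpace ℝ (Fin d)) 1)
  have h : ∀ᵐ ω ∂μ, ∀ k i m, |f k (inner ℝ (a i ω) (z m : EuclideanSpace ℝ (Fin d)))| ≤ B k := by
    simp_rw [ae_all_iff]
    exact fun k i m => hB k _ (mem_closedBall_zero_iff.mp (z m).2) i
  filter_upwards [h] with ω hω k i x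
  refine (TopologicalSpace.denseRange_denseSeq
    (Metric.closedBall (0 : EuclideanSpace ℝ (Fin d)) 1)).induction_on
    (p := fun x => |f k (inner ℝ (a i ω) (x : EuclideanSpace ℝ (Fin d)))| ≤ B k) x
    (isClosed_le ?_ continuous_const) fun m => hω k i m
  exact ((hf k).comp (by fun_prop)).abs

/-- In dimension one every admissible `y` is a multiple, by a factor at most `1` in absolute value,
of one unit vector, which therefore dominates. The one-point bound applies without entropy cost. -/
lemma measureReal_exists_sum_truncPow_gt_le_of_dim_one {r : ℕ} (hr : 2 ≤ r) {Ω : Type*}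
    [MeasurableSpace Ω] (μ : Measure Ω) [IsProbabilityMeasure μ] {n : ℕ}
    {G : Fin n → Ω → EuclideanSpace ℝ (Fin 1)} (hG : ∀ i, Measurable (G i)) (hind : iIndepFun G μ)
    (htail : ∀ i, HasIsotropicGaussianTail μ (G i)) {τ : Fin 1 → ℝ} (hτ : ∀ i, 0 < τ i)
    (hτ1 : ∀ i, τ i ≤ 1) {b : ℝ} (hb : 0 < b) (lam : ℝ) :
    μ.real {ω | ∃ y : EuclideanSpace ℝ (Fin 1), ∑ l, (y l / τ l) ^ 2 ≤ 1 ∧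
      n * momentConst r + 8 * b ^ (r - 2) * lam <
        ∑ i, truncPow r b (inner ℝ (G i ω) y)} ≤ Real.exp (-lam) := by
  have h := measureReal_sum_truncPow_ge_le hr μ hG hind htail hb one_pos
    (y := EuclideanSpace.single 0 (1 : ℝ)) (by simp) lam
  refine (measureReal_mono ?_).trans h
  rintro ω ⟨y, hy, hgt⟩
  simp only [Set.mem_ofPred_eq, one_pow, one_mul, mul_one]
  refine hgt.le.trans (Finset.sum_le_sum fun i _ => ?_)
  have hy1 : |y 0| ≤ 1 := by
    rw [Fin.sum_univ_one, div_pow, div_le_one (pow_pos (hτ 0) 2)] at hy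
    rw [← sq_le_one_iff_abs_le_one]
    exact hy.trans (pow_le_one₀ (hτ 0).le (hτ1 0))
  unfold truncPow
  refine pow_le_pow_left₀ (le_min hb.le (abs_nonneg _)) (min_le_min_left _ ?_) r
  have : inner ℝ (G i ω) y = y 0 * inner ℝ (G i ω) (EuclideanSpace.single 0 (1 : ℝ)) := by
    simp [PiLp.inner_apply]
  rw [this, abs_mul]
  exact mul_le_of_le_one_left (abs_nonneg _) hy1

/-- Each of the `r` points `x k` yields a point of the ellipsoid, so each contributes at most `X`
after summation over the sample; hence the factor `r`. -/
lemma uncenteredSup_le {r d n : ℕ} (hr : 0 < r) (hd : 1 ≤ d) (hn : 1 ≤ n)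
    {S : Matrix (Fin d) (Fin d) ℝ} (hS : S.PosDef) {f : Fin r → ℝ → ℝ}
    (hf : ∀ k, LipschitzWith 1 (f k)) (hf0 : ∀ k, f k 0 = 0) {B : Fin r → ℝ}
    {a : Fin n → EuclideanSpace ℝ (Fin d)} {b : ℝ} (hb : 0 ≤ b)
    (hbB : ∏ k, B k = specSigmaMax hS.isHermitian ^ r * b ^ r)
    (hB : ∀ k i, ∀ x : Metric.closedBall (0 : EuclideanSpace ℝ (Fin d)) 1,
      |f k (inner ℝ (a i) (x : EuclideanSpace ℝ (Fin d)))| ≤ B k) {X : ℝ}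
    (hX : ∀ y : EuclideanSpace ℝ (Fin d),
      ∑ l, (y l / (specSigma hS.isHermitian l / specSigmaMax hS.isHermitian)) ^ 2 ≤ 1 →
      ∑ i, truncPow r b (inner ℝ (whiten hS.isHermitian (a i)) y) ≤ X) :
    uncenteredSup f a ≤ specSigmaMax hS.isHermitian ^ r * (r * X / n) := by
  have : Nonempty (Fin r → Metric.closedBall (0 : EuclideanSpace ℝ (Fin d)) 1) :=
    ⟨fun _ => ⟨0, by simp⟩⟩
  have hs := specSigmaMax_pos hS hd
  set s := specSigmaMax hS.isHermitian
  have hn0 : (0 : ℝ) < n := by exact_mod_cast hn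
  refine ciSup_le fun x => ?_
  let v : Fin n → Fin r → ℝ := fun i k =>
    inner ℝ (whiten hS.isHermitian (a i)) (ellipsoidPoint hS.isHermitian (x k))
  have hprod : ∀ i, ∏ k, f k (inner ℝ (a i) (x k : EuclideanSpace ℝ (Fin d))) ≤
      s ^ r * ∑ k, truncPow r b (v i k) := by
    intro i
    refine prod_le_sum_truncPow hr hs.le hb (fun k => ?_) ?_
    · have h1 := (hf k).dist_le_mul (inner ℝ (a i) (x k : EuclideanSpace ℝ (Fin d))) 0
      rw [hf0 k, Real.dist_eq, Real.dist_eq, sub_zero, sub_zero, NNReal.coe_one, one_mul] at h1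
      refine h1.trans_eq ?_
      rw [inner_eq_mul_inner_whiten hS hd, abs_mul, abs_of_pos hs]
    · rw [← hbB]
      exact Finset.prod_le_prod (fun k _ => abs_nonneg _) fun k _ => hB k i (x k)
  calc 1 / (n : ℝ) * ∑ i, ∏ k, f k (inner ℝ (a i) (x k : EuclideanSpace ℝ (Fin d)))
      ≤ 1 / (n : ℝ) * ∑ i, s ^ r * ∑ k, truncPow r b (v i k) := by
        gcongr with i; exact hprod i
    _ = 1 / (n : ℝ) * (s ^ r * ∑ k, ∑ i, truncPow r b (v i k)) := by
        rw [← Finset.mul_sum, Finset.sum_comm]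
    _ ≤ 1 / (n : ℝ) * (s ^ r * ∑ _k : Fin r, X) := by
        gcongr with k
        refine hX _ ((sum_ellipsoidPoint_sq hS hd _).trans_le ?_)
        exact pow_le_one₀ (norm_nonneg _) (mem_closedBall_zero_iff.mp (x k).2)
    _ = s ^ r * (r * X / n) := by
        rw [Finset.sum_const, Finset.card_univ, Fintype.card_fin, nsmul_eq_mul]; ring

/-- The uniform bound with the additive constants absorbed into `d_eff log d`. -/
lemma exists_level_sum_truncPow {r : ℕ} (hr : 2 ≤ r) {d n : ℕ} (hd : 1 ≤ d) (hn : 1 ≤ n)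
    {S : Matrix (Fin d) (Fin d) ℝ} (hS : S.PosDef) {Ω : Type*} [MeasurableSpace Ω] (μ : Measure Ω)
    [IsProbabilityMeasure μ] {G : Fin n → Ω → EuclideanSpace ℝ (Fin d)}
    (hG : ∀ i, Measurable (G i)) (hind : iIndepFun G μ)
    (htail : ∀ i, HasIsotropicGaussianTail μ (G i)) {b lam : ℝ} (hb : 0 < b) (hlam : 0 < lam) :
    ∃ X : ℝ, X < n * ((4 * chainConst r + momentConst r + 8) *
        (1 + (effDim hS.isHermitian r * Real.log d + lam) / n * b ^ (r - 2))) ∧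
      μ.real {ω | ∃ y : EuclideanSpace ℝ (Fin d),
        ∑ l, (y l / (specSigma hS.isHermitian l / specSigmaMax hS.isHermitian)) ^ 2 ≤ 1 ∧
        X < ∑ i, truncPow r b (inner ℝ (G i ω) y)} ≤ Real.exp (-lam) := by
  have hs := specSigmaMax_pos hS hd
  have hτ : ∀ l, 0 < specSigma hS.isHermitian l / specSigmaMax hS.isHermitian :=
    fun l => div_pos (specSigma_pos hS l) hs
  have hτ1 : ∀ l, specSigma hS.isHermitian l / specSigmaMax hS.isHermitian ≤ 1 :=
    fun l => (div_le_one hs).mpr (specSigma_le_max _ l)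
  have hK := chainConst_pos (r := r) (by omega)
  have hM := momentConst_pos r
  have hn0 : (0 : ℝ) < n := by exact_mod_cast hn
  have hq : 0 < b ^ (r - 2) := by positivity
  set q := b ^ (r - 2)
  have hexpand : n * ((4 * chainConst r + momentConst r + 8) *
      (1 + (effDim hS.isHermitian r * Real.log d + lam) / n * q)) =
      (4 * chainConst r + momentConst r + 8) *
        (n + (effDim hS.isHermitian r * Real.log d + lam) * q) := by field_simp
  rw [hexpand]
  -- For `d = 1` the term in `log d` vanishes and cannot absorb the `E + 1` of the chaining bound.
  rcases hd.eq_or_lt with rfl | hd2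
  · refine ⟨_, ?_, measureReal_exists_sum_truncPow_gt_le_of_dim_one hr μ hG hind htail hτ hτ1 hb
      lam⟩
    rw [Nat.cast_one, Real.log_one, mul_zero, zero_add]
    change _ + 8 * q * lam < _
    nlinarith [mul_pos hlam hq, mul_pos hK (mul_pos hlam hq), mul_pos hM (mul_pos hlam hq),
      mul_pos hK hn0]
  · refine ⟨_, ?_, measureReal_exists_sum_truncPow_gt_le hr μ hG hind htail hτ hτ1 hb hlam.le⟩
    change chainConst r * (n + q * (lam + effDim hS.isHermitian r + 1)) < _
    have hE := one_le_effDim hS hd r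
    set E := effDim hS.isHermitian r
    have hlog : 2 / 3 ≤ Real.log d := by
      have h1 : Real.log 2 ≤ Real.log d :=
        Real.log_le_log (by norm_num) (by exact_mod_cast hd2)
      linarith [Real.log_two_gt_d9]
    -- Since `E ≥ 1` and `log d ≥ 2/3`, one has `E + 1 ≤ 2 * E ≤ 3 * E * log d`.
    have h1 : lam + E + 1 ≤ 4 * (E * Real.log d + lam) := by nlinarith
    have h2 : chainConst r * (n + q * (lam + E + 1)) ≤
        4 * chainConst r * (n + (E * Real.log d + lam) * q) := by
      have := mul_le_mul_of_nonneg_left h1 hq.le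
      nlinarith
    have h3 : 0 < n + (E * Real.log d + lam) * q := by
      have : 0 < E * Real.log d + lam := by nlinarith
      positivity
    nlinarith

theorem theorem2 (r : ℕ) (hr : 2 ≤ r) :
    ∃ C : ℝ, 0 < C ∧
      ∀ (d n : ℕ), 1 ≤ d → 1 ≤ n →
      ∀ (S : Matrix (Fin d) (Fin d) ℝ) (hS : S.PosDef)
        (Ω : Type*) [MeasurableSpace Ω] (μ : Measure Ω) [IsProbabilityMeasure μ]
        (a : Fin n → Ω → EuclideanSpace ℝ (Fin d)),
        (∀ i, Measurable (a i)) →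
        iIndepFun a μ →
        (∀ i j, IdentDistrib (a i) (a j) μ μ) →
        (∀ i, IsMatrixSubgaussian μ S (a i)) →
      ∀ (f : Fin r → ℝ → ℝ),
        (∀ k, LipschitzWith 1 (f k)) →
        (∀ k, f k 0 = 0) →
      ∀ (B : Fin r → ℝ),
        (∀ k, 0 < B k) →
        (∀ k, ∀ x : EuclideanSpace ℝ (Fin d), ‖x‖ ≤ 1 → ∀ i,
          ∀ᵐ ω ∂μ, |f k (inner ℝ (a i ω) x)| ≤ B k) →
      ∀ lam : ℝ, 0 < lam →
        μ.real {ω | specSigmaMax hS.isHermitian ^ r * C *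
            (1 + (effDim hS.isHermitian r * Real.log d + lam) / n *
              ((specSigmaMax hS.isHermitian ^ r)⁻¹ * ∏ k, B k) ^ (1 - 2 / (r : ℝ)))
            ≤ uncenteredSup f (fun i => a i ω)} ≤ Real.exp (-lam) := by
  have hr0 : 0 < r := by omega
  have hrpos : (0 : ℝ) < r := by exact_mod_cast hr0
  have hK := chainConst_pos hr0
  have hM := momentConst_pos r
  refine ⟨r * (4 * chainConst r + momentConst r + 8), by positivity, ?_⟩
  intro d n hd hn S hS Ω _ μ _ a ha hind _ hsub f hf hf0 B hB0 hB lam hlam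
  have hs := specSigmaMax_pos hS hd
  set s := specSigmaMax hS.isHermitian
  have hn0 : (0 : ℝ) < n := by exact_mod_cast hn
  have hQ : 0 < (s ^ r)⁻¹ * ∏ k, B k :=
    mul_pos (by positivity) (Finset.prod_pos fun k _ => hB0 k)
  set Q := (s ^ r)⁻¹ * ∏ k, B k with hQdef
  -- This truncation level makes the cap `s^r * b^r` equal to the product of the bounds `B k`, and
  -- `b^{r-2}` equal to `Q^{1-2/r}`.
  set b := Q ^ (1 / (r : ℝ)) with hbdef
  have hb : 0 < b := Real.rpow_pos_of_pos hQ _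
  have hbr : b ^ r = Q := by
    rw [hbdef, ← Real.rpow_natCast, ← Real.rpow_mul hQ.le, one_div_mul_cancel hrpos.ne',
      Real.rpow_one]
  have hbr2 : Q ^ (1 - 2 / (r : ℝ)) = b ^ (r - 2) := by
    rw [hbdef, ← Real.rpow_natCast, ← Real.rpow_mul hQ.le, Nat.cast_sub hr]
    congr 1
    push_cast
    field_simp
  have hbB : ∏ k, B k = s ^ r * b ^ r := by
    rw [hbr, hQdef, mul_inv_cancel_left₀ (by positivity)]
  obtain ⟨X, hX, hXp⟩ := exists_level_sum_truncPow hr hd hn hS μ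
    (G := fun i ω => whiten hS.isHermitian (a i ω))
    (fun i => (measurable_whiten _).comp (ha i))
    (hind.comp (fun _ => whiten hS.isHermitian) fun _ => measurable_whiten _)
    (fun i => (hsub i).whiten hS) hb hlam
  refine le_trans (ENNReal.toReal_mono (measure_ne_top _ _) (measure_mono_ae ?_)) hXp
  filter_upwards [ae_forall_abs_le (fun k => (hf k).continuous) hB] with ω hω hge
  by_contra hcon
  have hle : ∀ y : EuclideanSpace ℝ (Fin d),
      ∑ l, (y l / (specSigma hS.isHermitian l / s)) ^ 2 ≤ 1 →
      ∑ i, truncPow r b (inner ℝ (whiten hS.isHermitian (a i ω)) y) ≤ X := fun y hy =>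
    not_lt.mp fun hlt => hcon ⟨y, hy, hlt⟩
  have hsup := uncenteredSup_le hr0 hd hn hS hf hf0 hb.le hbB hω hle
  have hge' : s ^ r * (r * (4 * chainConst r + momentConst r + 8)) *
      (1 + (effDim hS.isHermitian r * Real.log d + lam) / n * Q ^ (1 - 2 / (r : ℝ))) ≤
      uncenteredSup f (fun i => a i ω) := hge
  rw [hbr2] at hge'
  -- The event allows equality with the threshold; the contradiction relies on `X` being strictly
  -- below its scaled value.
  refine (hge'.trans hsup).not_gt ?_
  rw [mul_assoc, mul_assoc (r : ℝ), mul_div_assoc]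
  gcongr
  rwa [div_lt_iff₀' hn0]
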